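/- Let $\ell^1$ be the space of absolutely summable real sequences $x=(x_1,x_2,\dots)$ with norm $\|x\|=\sum_k|x_k|$. For $r\ge 0$ put $S_r=\{x\in\ell^1:\ x_k\ge 0\ \text{for all }k,\ \|x\|=r\}$, $\operatorname{ri}S_r=\{x\in S_r:\ x_k>0\ \text{for all }k\}$, $\partial S_r=S_r\setminus \operatorname{ri}S_r$, and write $S=S_1$, $\partial S=\partial S_1$. A Volterra operator is a map $V:S\to S$ of the form $$(V(x))_k=x_k\Big(1+\sum_{i=1}^\infty a_{ki}x_i\Big),\qquad k\in\mathbb N,$$ where $(a_{ki})$ is a real matrix with $a_{ki}=-a_{ik}$ and $|a_{ki}|\le 1$ for all $k,i\in\mathbb N$. Let $\tilde{\mathcal V}^+$ (resp. $\tilde{\mathcal V}^-$) be the set of Volterra operators for which there is an integer $k_0\ge 1$ such that $a_{ki}=0$ whenever $k<k_0\le i$, and $a_{ki}\ge 0$ (resp. $a_{ki}\le 0$) whenever $k_0\le k<i$. For $x_0\in S$ let $$\omega_V(x_0)=\bigcap_{n\ge 1}\overline{\{V^k(x_0):k\ge n\}}^{\,\|\cdot\|},\qquad \omega_V^{(w)}(x_0)=\bigcap_{n\ge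 1}\overline{\{V^k(x_0):k\ge n\}}^{\,\mathrm{pw}},$$ where the first closure is taken in $\ell^1$ for the norm and the second in the space of all real sequences for the topology of pointwise convergence. Let $\operatorname{Fix}(V)=\{x\in S: V(x)=x\}$. **Theorem.** Let $V\in\tilde{\mathcal V}^+\cup\tilde{\mathcal V}^-$ with $V\ne \mathrm{Id}$. (i) If $V\in\tilde{\mathcal V}^+$, then $\omega_V(x_0)=\omega_V^{(w)}(x_0)\neq\emptyset$ for every $x_0\in S$, and $\omega_V^{(w)}(x_0)\subset\partial S$ for every $x_0\in S\setminus\operatorname{Fix}(V)$. (ii) If $V\in\tilde{\mathcal V}^-$, then for every $x_0\in S\setminus\operatorname{Fix}(V)$: (a) if $\omega_V(x_0)\ne\emptyset$, then $\omega_V(x_0)=\omega_V^{(w)}(x_0)\subset\partial S$; (b) if $\omega_V(x_0)=\emptyset$, then there is $r\in[0,1)$ such that $\emptyset\neq\omega_V^{(w)}(x_0)\subset\partial S_r$. -/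

import Mathlib

open Set Filter Topology
open scoped ENNReal

noncomputable section

/-- The space `ℓ¹` of absolutely summable real sequences, with the norm `‖x‖ = ∑ |x k|`.
Sequences are indexed by `ℕ` starting from `0`. -/
abbrev EllOne : Type := lp (fun _ : ℕ => ℝ) 1

/-- The inclusion of `ℓ¹` into the space `s` of all real sequences; `s` is `ℕ → ℝ`, whose
(product) topology is the topology of pointwise convergence. -/
def toSeq (x : EllOne) : ℕ → ℝ := fun k => x k

/-- `S_r`: the nonnegative elements of `ℓ¹` of norm `r`. -/
def simplexOfRadius (r : ℝ) : Set EllOne := {x | (∀ k, 0 ≤ x k) ∧ ‖x‖ = r}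

/-- `ri S_r`: the elements of `S_r` with all coordinates positive. -/
def riSimplex (r : ℝ) : Set EllOne := {x ∈ simplexOfRadius r | ∀ k, 0 < x k}

/-- `∂S_r = S_r \ ri S_r`. -/
def bdSimplex (r : ℝ) : Set EllOne := simplexOfRadius r \ riSimplex r

/-- The infinite dimensional simplex `S = S_1`, as a type. -/
abbrev InfSimplex : Type := simplexOfRadius 1

/-- The set `𝔸` of skew-symmetric matrices with entries in `[-1, 1]`. -/
def SkewMatrices : Set (ℕ → ℕ → ℝ) :=
  {a | (∀ k i, a k i = -a i k) ∧ ∀ k i, |a k i| ≤ 1}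

/-- `V : S → S` is the Volterra operator with matrix `a`:
`V(x)_k = x_k (1 + ∑_i a_{ki} x_i)`. -/
def IsVolterraWith (V : InfSimplex → InfSimplex) (a : ℕ → ℕ → ℝ) : Prop :=
  a ∈ SkewMatrices ∧
    ∀ (x : InfSimplex) (k : ℕ), (V x).1 k = x.1 k * (1 + ∑' i, a k i * x.1 i)

/-- The class `Ṽ⁺`: Volterra operators whose matrix is block diagonal, with a finite first block
of some size `m ≥ 0` (arbitrary skew-symmetric) and a second block with entries `≥ 0` above the
diagonal. -/
def VolterraPlusTilde : Set (InfSimplex → InfSimplex) :=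
  {V | ∃ a, IsVolterraWith V a ∧ ∃ m : ℕ,
    (∀ k i, k < m → m ≤ i → a k i = 0) ∧ ∀ k i, m ≤ k → k < i → 0 ≤ a k i}

/-- The class `Ṽ⁻`: as `Ṽ⁺`, but with entries `≤ 0` above the diagonal in the second block. -/
def VolterraMinusTilde : Set (InfSimplex → InfSimplex) :=
  {V | ∃ a, IsVolterraWith V a ∧ ∃ m : ℕ,
    (∀ k i, k < m → m ≤ i → a k i = 0) ∧ ∀ k i, m ≤ k → k < i → a k i ≤ 0}

/-- The omega-limit set `ω_V(x₀) = ⋂_{n ≥ 1} closure {V^k(x₀) : k ≥ n}` for the `ℓ¹`-norm. -/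
def omegaNorm (V : InfSimplex → InfSimplex) (x₀ : InfSimplex) : Set EllOne :=
  ⋂ (n : ℕ) (_ : 1 ≤ n), closure {y | ∃ k, n ≤ k ∧ y = (V^[k] x₀).1}

/-- The omega-limit set `ω_V^{(w)}(x₀) = ⋂_{n ≥ 1} closure {V^k(x₀) : k ≥ n}` for pointwise
convergence, the closure being taken in the space of all real sequences. -/
def omegaPointwise (V : InfSimplex → InfSimplex) (x₀ : InfSimplex) : Set (ℕ → ℝ) :=
  ⋂ (n : ℕ) (_ : 1 ≤ n), closure {y | ∃ k, n ≤ k ∧ y = toSeq (V^[k] x₀).1}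

end

/-! By skew-symmetry, one step changes a head sum `∑_{k<N} x_k` only through pairs `k < N ≤ i`, and
for `N ≥ m` these terms have a common sign `σ`. So head sums are monotone along an orbit and
converge, and all pointwise cluster points (they exist since `[0,1]^ℕ` is compact) share one mass `r
≤ 1`. In the plus case no mass escapes to infinity, so `r = 1`; and when `r = 1`, Scheffé's lemma
upgrades pointwise to norm convergence.

A cluster point `y` with all coordinates positive forces the orbit to be stationary. The pair terms
vanish in the limit, so the second block of the matrix is zero and the first `m` coordinates form a
finite Volterra system with matrix `B`. For `p ≥ 0` with `B p ≥ 0`, the function `∑ p_k log u_k` is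
nonincreasing along the orbit, hence takes equal values at `y` and at its image; a strictly
complementary `p` (Tucker) then yields `B y = 0`. Now `p = y` is itself admissible, and the equality
case of Gibbs' inequality gives `u 0 = y`. -/

/-! ### Skew-symmetric systems of linear inequalities -/

/-- **Farkas' lemma** for finitely many linear functionals on an arbitrary real vector space. -/
theorem farkas_alternative {W ι : Type*} [AddCommGroup W] [Module ℝ W] (s : Finset ι) :
    ∀ (A : ι → W →ₗ[ℝ] ℝ) (b : W →ₗ[ℝ] ℝ),
      (∃ c : ι → ℝ, (∀ i, 0 ≤ c i) ∧ b = ∑ i ∈ s, c i • A i) ∨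
        ∃ x, (∀ i ∈ s, A i x ≤ 0) ∧ 0 < b x := by
  classical
  induction s using Finset.induction_on with
  | empty =>
    intro A b
    by_cases hb : b = 0
    · exact Or.inl ⟨0, by simp, by simp [hb]⟩
    · right
      obtain ⟨x, hx⟩ : ∃ x, b x ≠ 0 := by
        by_contra! h
        exact hb (LinearMap.ext h)
      exact ⟨b x • x, by simp, by simpa using mul_self_pos.mpr hx⟩
  | insert j s hj ih =>
    intro A b
    rcases ih A b with ⟨c, hc, rfl⟩ | ⟨x', hx', hbx'⟩
    · refine Or.inl ⟨Function.update c j 0, fun i => ?_, ?_⟩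
      · by_cases h : i = j
        · simp [h]
        · simpa [h] using hc i
      · rw [Finset.sum_insert hj, Function.update_self, zero_smul, zero_add]
        refine Finset.sum_congr rfl fun i hi => ?_
        rw [Function.update_of_ne (ne_of_mem_of_not_mem hi hj)]
    · by_cases hj' : A j x' ≤ 0
      · refine Or.inr ⟨x', fun i hi => ?_, hbx'⟩
        rcases Finset.mem_insert.mp hi with rfl | hi
        exacts [hj', hx' i hi]
      push Not at hj'
      set z := (A j x')⁻¹ • x' with hz
      have hAz : A j z = 1 := by simp [hz, hj'.ne']
      have hAi : ∀ i ∈ s, A i z ≤ 0 := fun i hi => by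
        simpa [hz] using mul_nonpos_of_nonneg_of_nonpos (inv_pos.mpr hj').le (hx' i hi)
      have hbz : 0 < b z := by simpa [hz] using mul_pos (inv_pos.mpr hj') hbx'
      -- Eliminate `A j`: the modified functionals are the old ones composed with the projection
      -- onto `ker (A j)` along `z`.
      rcases ih (fun i => A i - A i z • A j) (b - b z • A j) with ⟨c, hc, hb⟩ | ⟨x, hx, hbx⟩
      · left
        have hd : 0 ≤ b z - ∑ i ∈ s, c i * A i z := by
          have : ∑ i ∈ s, c i * A i z ≤ 0 :=
            Finset.sum_nonpos fun i hi => mul_nonpos_of_nonneg_of_nonpos (hc i) (hAi i hi)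
          linarith
        refine ⟨Function.update c j (b z - ∑ i ∈ s, c i * A i z), fun i => ?_, ?_⟩
        · by_cases h : i = j
          · simpa [h] using hd
          · simpa [h] using hc i
        · rw [Finset.sum_insert hj, Function.update_self]
          have : ∑ i ∈ s, Function.update c j (b z - ∑ i ∈ s, c i * A i z) i • A i
              = ∑ i ∈ s, c i • A i := Finset.sum_congr rfl fun i hi => by
            rw [Function.update_of_ne (ne_of_mem_of_not_mem hi hj)]
          rw [this]
          have hb' : b = b z • A j + ∑ i ∈ s, c i • (A i - A i z • A j) := by
            rw [← hb]; abel
          conv_lhs => rw [hb']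
          ext x
          simp only [LinearMap.add_apply, LinearMap.sub_apply, LinearMap.smul_apply,
            LinearMap.sum_apply, smul_eq_mul, mul_sub, Finset.sum_sub_distrib, sub_mul,
            Finset.sum_mul, mul_assoc]
          ring
      · refine Or.inr ⟨x - A j x • z, fun i hi => ?_, ?_⟩
        · rcases Finset.mem_insert.mp hi with rfl | hi
          · simp [hAz]
          · have := hx i hi
            simp only [LinearMap.sub_apply, LinearMap.smul_apply, smul_eq_mul, map_sub,
              map_smul] at this ⊢
            linarith
        · simp only [LinearMap.sub_apply, LinearMap.smul_apply, smul_eq_mul, map_sub,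
            map_smul] at hbx ⊢
          linarith

theorem sum_mul_sum_skew {ι : Type*} (s : Finset ι) {B : ι → ι → ℝ}
    (hB : ∀ k i, B k i = -B i k) (p q : ι → ℝ) :
    ∑ k ∈ s, p k * ∑ i ∈ s, B k i * q i = -∑ k ∈ s, q k * ∑ i ∈ s, B k i * p i := by
  simp only [Finset.mul_sum]
  rw [Finset.sum_comm, ← Finset.sum_neg_distrib]
  refine Finset.sum_congr rfl fun i _ => ?_
  rw [← Finset.sum_neg_distrib]
  refine Finset.sum_congr rfl fun k _ => ?_
  rw [hB k i]; ring

/-- Apply Farkas to `p ≥ 0`, `B p ≥ 0`, `(B p)_j > 0`. If this is infeasible, skew-symmetry turns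
the certificate into a solution with positive `j`-th coordinate. -/
theorem skew_exists_pos_at {ι : Type*} [Fintype ι] {B : ι → ι → ℝ}
    (hB : ∀ k i, B k i = -B i k) (j : ι) :
    ∃ p : ι → ℝ, (∀ k, 0 ≤ p k) ∧ (∀ k, 0 ≤ ∑ i, B k i * p i) ∧
      0 < p j + ∑ i, B j i * p i := by
  classical
  let row : ι → (ι → ℝ) →ₗ[ℝ] ℝ := fun k => ∑ i, B k i • LinearMap.proj i
  have hrow : ∀ k p, row k p = ∑ i, B k i * p i := fun k p => by
    simp [row, LinearMap.sum_apply]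
  rcases farkas_alternative (Finset.univ : Finset (ι ⊕ ι))
      (Sum.elim (fun i => -LinearMap.proj i) fun i => -row i) (row j) with
    ⟨c, hc, hb⟩ | ⟨p, hp, hpos⟩
  · have key : ∀ p : ι → ℝ, ∑ i, B j i * p i
        = -∑ i, c (Sum.inl i) * p i - ∑ i, c (Sum.inr i) * ∑ l, B i l * p l := fun p => by
      have := congrArg (fun f => f p) hb
      simp only [hrow, Fintype.sum_sum_type, LinearMap.add_apply, LinearMap.sum_apply,
        LinearMap.smul_apply, Sum.elim_inl, Sum.elim_inr, LinearMap.neg_apply,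
        LinearMap.proj_apply, smul_eq_mul, mul_neg, Finset.sum_neg_distrib] at this
      rw [this]; ring
    -- The multipliers of the rows plus the unit vector at `j`; `B q` is then the vector of the
    -- remaining multipliers.
    set q : ι → ℝ := fun i => c (Sum.inr i) + if i = j then 1 else 0 with hq
    have hq0 : ∀ i, 0 ≤ q i := fun i => by
      have := hc (Sum.inr i)
      simp only [hq]; split_ifs <;> linarith
    have hBq : ∀ k, ∑ i, B k i * q i = c (Sum.inl k) := fun k => by
      have h1 := key (Pi.single k 1)
      simp only [Pi.single_apply, mul_ite, mul_one, mul_zero, Finset.sum_ite_eq',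
        Finset.mem_univ, if_true] at h1
      simp only [hq, mul_add, mul_ite, mul_one, mul_zero, Finset.sum_add_distrib,
        Finset.sum_ite_eq', Finset.mem_univ, if_true]
      have h2 : ∑ i, B k i * c (Sum.inr i) = -∑ i, c (Sum.inr i) * B i k := by
        rw [← Finset.sum_neg_distrib]
        exact Finset.sum_congr rfl fun i _ => by rw [hB k i]; ring
      rw [h2, hB k j]; linarith
    refine ⟨q, hq0, fun k => by rw [hBq]; exact hc _, ?_⟩
    rw [hBq]
    have h1 := hc (Sum.inl j)
    have h2 := hc (Sum.inr j)
    simp only [hq, if_true]; linarith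
  · have hp0 : ∀ k, 0 ≤ p k := fun k => by simpa using hp (Sum.inl k) (Finset.mem_univ _)
    refine ⟨p, hp0, fun k => ?_, ?_⟩
    · have := hp (Sum.inr k) (Finset.mem_univ _)
      simpa [hrow] using this
    · rw [hrow] at hpos
      linarith [hp0 j]

/-- **Tucker's theorem** on skew-symmetric systems: a skew-symmetric system `p ≥ 0`, `B p ≥ 0`
has a strictly complementary solution. -/
theorem skew_exists_strictly_complementary {ι : Type*} [Fintype ι] {B : ι → ι → ℝ}
    (hB : ∀ k i, B k i = -B i k) :
    ∃ p : ι → ℝ, (∀ k, 0 ≤ p k) ∧ (∀ k, 0 ≤ ∑ i, B k i * p i) ∧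
      ∀ k, 0 < p k + ∑ i, B k i * p i := by
  choose p hp hBp hpos using skew_exists_pos_at hB
  have hsum : ∀ k, ∑ i, B k i * ∑ j, p j i = ∑ j, ∑ i, B k i * p j i := fun k => by
    simp only [Finset.mul_sum]; exact Finset.sum_comm
  -- Solutions form a cone, so those found for each `j` can be added.
  refine ⟨fun i => ∑ j, p j i, fun k => Finset.sum_nonneg fun j _ => hp j k, fun k => ?_,
    fun k => ?_⟩
  · rw [hsum]; exact Finset.sum_nonneg fun j _ => hBp j k
  · rw [hsum, ← Finset.sum_add_distrib]
    exact Finset.sum_pos' (fun j _ => add_nonneg (hp j k) (hBp j k)) ⟨k, Finset.mem_univ _, hpos k⟩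

/-! ### Logarithmic Lyapunov functions in finite dimension -/

section FiniteVolterra

variable {ι : Type*} [Fintype ι] {B : ι → ι → ℝ}

/-- Skew-symmetry turns `p · B v` into `-v · B p`. If `p ≥ 0` and `B p ≥ 0`, both subtracted sums
are nonnegative for `v > 0`, because `log (1 + t) ≤ t`. -/
theorem sum_mul_log_volterra (hB : ∀ k i, B k i = -B i k) (p v : ι → ℝ) (hv : ∀ k, 0 < v k)
    (hf : ∀ k, 0 < 1 + ∑ i, B k i * v i) :
    ∑ k, p k * Real.log (v k * (1 + ∑ i, B k i * v i)) =
      ∑ k, p k * Real.log (v k) - ∑ k, v k * ∑ i, B k i * p i -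
        ∑ k, p k * ((∑ i, B k i * v i) - Real.log (1 + ∑ i, B k i * v i)) := by
  have h := sum_mul_sum_skew Finset.univ hB v p
  rw [h, sub_neg_eq_add, ← Finset.sum_add_distrib, ← Finset.sum_sub_distrib]
  refine Finset.sum_congr rfl fun k _ => ?_
  rw [Real.log_mul (hv k).ne' (hf k).ne']; ring

theorem log_one_add_le {t : ℝ} (ht : 0 < 1 + t) : Real.log (1 + t) ≤ t := by
  linarith [Real.log_le_sub_one_of_pos ht]

theorem eq_zero_of_log_one_add_eq {t : ℝ} (ht : 0 < 1 + t) (h : t - Real.log (1 + t) = 0) :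
    t = 0 := by
  by_contra h0
  have := Real.log_lt_sub_one_of_pos ht (by intro h1; apply h0; linarith)
  linarith

/-- If a positive orbit of a finite-dimensional Volterra operator has a positive cluster point,
then it is stationary. -/
theorem finite_volterra_stationary (hB : ∀ k i, B k i = -B i k) {u : ℕ → ι → ℝ}
    (hu : ∀ n k, 0 < u n k) (hstep : ∀ n k, u (n + 1) k = u n k * (1 + ∑ i, B k i * u n i))
    {y : ι → ℝ} (hy : ∀ k, 0 < y k) (hfy : ∀ k, 0 < 1 + ∑ i, B k i * y i)
    {φ : ℕ → ℕ} (hφ : StrictMono φ) (hlim : ∀ k, Tendsto (fun j => u (φ j) k) atTop (𝓝 (y k))) :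
    (∀ k, ∑ i, B k i * y i = 0) ∧ u 0 = y := by
  have hfu : ∀ n k, 0 < 1 + ∑ i, B k i * u n i := fun n k => by
    have h := hu (n + 1) k
    rw [hstep] at h
    exact (pos_iff_pos_of_mul_pos h).mp (hu n k)
  have hslack : ∀ (p v : ι → ℝ), (∀ k, 0 ≤ p k) → (∀ k, 0 < 1 + ∑ i, B k i * v i) →
      0 ≤ ∑ k, p k * ((∑ i, B k i * v i) - Real.log (1 + ∑ i, B k i * v i)) :=
    fun p v hp hv => Finset.sum_nonneg fun k _ =>
      mul_nonneg (hp k) (sub_nonneg.mpr (log_one_add_le (hv k)))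
  have hanti : ∀ p : ι → ℝ, (∀ k, 0 ≤ p k) → (∀ k, 0 ≤ ∑ i, B k i * p i) →
      Antitone fun n => ∑ k, p k * Real.log (u n k) := fun p hp hBp => by
    refine antitone_nat_of_succ_le fun n => ?_
    simp only [hstep]
    rw [sum_mul_log_volterra hB p (u n) (hu n) (hfu n)]
    have h1 := hslack p (u n) hp (hfu n)
    have h2 : 0 ≤ ∑ k, u n k * ∑ i, B k i * p i :=
      Finset.sum_nonneg fun k _ => mul_nonneg (hu n k).le (hBp k)
    linarith
  have hconv : ∀ p : ι → ℝ, (∀ k, 0 ≤ p k) → (∀ k, 0 ≤ ∑ i, B k i * p i) →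
      Tendsto (fun n => ∑ k, p k * Real.log (u n k)) atTop
        (𝓝 (∑ k, p k * Real.log (y k))) := fun p hp hBp => by
    rw [tendsto_iff_tendsto_subseq_of_antitone (hanti p hp hBp) hφ.tendsto_atTop]
    exact tendsto_finsetSum _ fun k _ => ((hlim k).log (hy k).ne').const_mul _
  have hBu : ∀ k, Tendsto (fun j => ∑ i, B k i * u (φ j) i) atTop (𝓝 (∑ i, B k i * y i)) :=
    fun k => tendsto_finsetSum _ fun i _ => (hlim i).const_mul _
  have hinv : ∀ p : ι → ℝ, (∀ k, 0 ≤ p k) → (∀ k, 0 ≤ ∑ i, B k i * p i) →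
      ∑ k, p k * Real.log (y k * (1 + ∑ i, B k i * y i)) = ∑ k, p k * Real.log (y k) :=
    fun p hp hBp => by
    -- The whole sequence converges, so the shifted subsequence `φ j + 1`, which tends to the image
    -- of `y`, has the same limit.
    have h1 := (hconv p hp hBp).comp ((tendsto_add_atTop_nat 1).comp hφ.tendsto_atTop)
    refine tendsto_nhds_unique ?_ h1
    simp only [Function.comp_def, hstep]
    exact tendsto_finsetSum _ fun k _ =>
      (((hlim k).mul ((hBu k).const_add 1)).log (mul_pos (hy k) (hfy k)).ne').const_mul _
  have hBy : ∀ k, ∑ i, B k i * y i = 0 := by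
    obtain ⟨p, hp, hBp, hpp⟩ := skew_exists_strictly_complementary hB
    have h0 := hinv p hp hBp
    rw [sum_mul_log_volterra hB p y hy hfy] at h0
    have h1 := hslack p y hp hfy
    have hnn : ∀ k ∈ Finset.univ, 0 ≤ y k * ∑ i, B k i * p i :=
      fun k _ => mul_nonneg (hy k).le (hBp k)
    have h2 := Finset.sum_nonneg hnn
    have h3 : ∑ k, y k * ∑ i, B k i * p i = 0 := by linarith
    have h4 : ∑ k, p k * ((∑ i, B k i * y i) - Real.log (1 + ∑ i, B k i * y i)) = 0 := by
      linarith
    intro k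
    have h5 := (Finset.sum_eq_zero_iff_of_nonneg hnn).mp h3 k (Finset.mem_univ k)
    have h6 := (Finset.sum_eq_zero_iff_of_nonneg fun k _ =>
      mul_nonneg (hp k) (sub_nonneg.mpr (log_one_add_le (hfy k)))).mp h4 k (Finset.mem_univ k)
    -- `y > 0` forces `B p = 0`, so strict complementarity makes every `p k` positive.
    have hpk : p k ≠ 0 := by
      have h7 := (mul_eq_zero.mp h5).resolve_left (hy k).ne'
      have := hpp k
      rw [h7] at this
      linarith
    exact eq_zero_of_log_one_add_eq (hfy k) ((mul_eq_zero.mp h6).resolve_left hpk)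
  refine ⟨hBy, ?_⟩
  have hsumstep : ∀ n, ∑ k, u n k = ∑ k, u 0 k := fun n => by
    induction n with
    | zero => rfl
    | succ n ih =>
      rw [← ih]
      simp only [hstep, mul_add, mul_one, Finset.sum_add_distrib]
      have := sum_mul_sum_skew Finset.univ hB (u n) (u n)
      linarith
  have hsum : ∑ k, u 0 k = ∑ k, y k := by
    refine tendsto_nhds_unique (f := fun j => ∑ k, u (φ j) k) ?_
      (tendsto_finsetSum _ fun k _ => hlim k)
    simp only [hsumstep]
    exact tendsto_const_nhds
  have hle : ∑ k, y k * Real.log (y k) ≤ ∑ k, y k * Real.log (u 0 k) :=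
    (hanti y (fun k => (hy k).le) fun k => (hBy k).ge).le_of_tendsto
      (hconv y (fun k => (hy k).le) fun k => (hBy k).ge) 0
  -- Gibbs' inequality, written as `t - log (1 + t) ≥ 0` with `t = u 0 k / y k - 1`.
  have hterm : ∀ k, 0 < 1 + (u 0 k / y k - 1) := fun k => by
    have := div_pos (hu 0 k) (hy k); linarith
  have hnn : ∀ k ∈ Finset.univ,
      0 ≤ y k * ((u 0 k / y k - 1) - Real.log (1 + (u 0 k / y k - 1))) := fun k _ =>
    mul_nonneg (hy k).le (sub_nonneg.mpr (log_one_add_le (hterm k)))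
  have hzero : ∑ k, y k * ((u 0 k / y k - 1) - Real.log (1 + (u 0 k / y k - 1))) = 0 := by
    refine le_antisymm ?_ (Finset.sum_nonneg hnn)
    have : ∀ k, y k * ((u 0 k / y k - 1) - Real.log (1 + (u 0 k / y k - 1)))
        = u 0 k - y k - y k * Real.log (u 0 k) + y k * Real.log (y k) := fun k => by
      rw [add_sub_cancel, Real.log_div (hu 0 k).ne' (hy k).ne']
      field_simp [(hy k).ne']
      ring
    simp only [this, Finset.sum_add_distrib, Finset.sum_sub_distrib]
    linarith
  funext k
  have h1 := (Finset.sum_eq_zero_iff_of_nonneg hnn).mp hzero k (Finset.mem_univ k)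
  have h2 := eq_zero_of_log_one_add_eq (hterm k) ((mul_eq_zero.mp h1).resolve_left (hy k).ne')
  have h3 : u 0 k / y k = 1 := by linarith
  exact (div_eq_one_iff_eq (hy k).ne').mp h3

end FiniteVolterra

/-! ### Cluster points and convergence in `ℓ¹` -/

theorem mem_iInter_closure_tail_iff {E : Type*} [TopologicalSpace E] [FirstCountableTopology E]
    (u : ℕ → E) (y : E) :
    (y ∈ ⋂ (n : ℕ) (_ : 1 ≤ n), closure {z | ∃ k, n ≤ k ∧ z = u k}) ↔
      ∃ φ : ℕ → ℕ, StrictMono φ ∧ Tendsto (fun j => u (φ j)) atTop (𝓝 y) := by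
  constructor
  · intro h
    refine MapClusterPt.tendsto_subseq (mapClusterPt_iff_frequently.mpr fun s hs => ?_)
    rw [frequently_atTop]
    intro n
    have h1 := mem_iInter₂.mp h (n + 1) (by omega)
    obtain ⟨_, hz, k, hk, rfl⟩ := mem_closure_iff_nhds.mp h1 s hs
    exact ⟨k, by omega, hz⟩
  · rintro ⟨φ, hφ, hlim⟩
    refine mem_iInter₂.mpr fun n _ => mem_closure_of_tendsto hlim ?_
    filter_upwards [hφ.tendsto_atTop.eventually_ge_atTop n] with j hj
    exact ⟨φ j, hj, rfl⟩

theorem EllOne.summable_abs (x : EllOne) : Summable fun k => |x k| := by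
  simpa using (lp.hasSum_norm (p := 1) (by simp) x).summable

theorem EllOne.norm_eq_tsum (x : EllOne) : ‖x‖ = ∑' k, |x k| := by
  simpa using lp.norm_eq_tsum_rpow (p := 1) (by simp) x

theorem hasSum_of_mem_simplexOfRadius {r : ℝ} {x : EllOne} (hx : x ∈ simplexOfRadius r) :
    HasSum (fun k => x k) r := by
  have h := EllOne.norm_eq_tsum x
  have hs := EllOne.summable_abs x
  simp only [abs_of_nonneg (hx.1 _)] at h hs
  rw [← hx.2, h]
  exact hs.hasSum

theorem exists_mem_simplexOfRadius {r : ℝ} {y : ℕ → ℝ} (hy : ∀ k, 0 ≤ y k) (hr : HasSum y r) :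
    ∃ z ∈ simplexOfRadius r, toSeq z = y := by
  have hmem : Memℓp y 1 := memℓp_gen (by simpa [abs_of_nonneg (hy _)] using hr.summable)
  refine ⟨⟨y, hmem⟩, ⟨hy, ?_⟩, rfl⟩
  rw [EllOne.norm_eq_tsum]
  change ∑' k, |y k| = r
  simp only [abs_of_nonneg (hy _), hr.tsum_eq]

theorem continuous_toSeq : Continuous toSeq :=
  continuous_pi fun k => by
    refine LipschitzWith.continuous (K := 1) (LipschitzWith.of_dist_le_mul fun x y => ?_)
    rw [dist_eq_norm, dist_eq_norm]
    simpa [toSeq] using lp.norm_apply_le_norm one_ne_zero (x - y) k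

theorem isClosed_simplexOfRadius (r : ℝ) : IsClosed (simplexOfRadius r) := by
  have h : simplexOfRadius r = (⋂ k, {x : EllOne | 0 ≤ toSeq x k}) ∩ {x | ‖x‖ = r} := by
    ext x; simp [simplexOfRadius, toSeq]
  rw [h]
  exact (isClosed_iInter fun k => isClosed_le continuous_const
    ((continuous_apply k).comp continuous_toSeq)).inter (isClosed_eq continuous_norm continuous_const)

/-- **Scheffé's lemma** in `ℓ¹`. -/
theorem tendsto_of_tendsto_coord {r : ℝ} {w : ℕ → EllOne} (hw : ∀ j, w j ∈ simplexOfRadius r)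
    {z : EllOne} (hz : z ∈ simplexOfRadius r)
    (h : Tendsto (fun j => toSeq (w j)) atTop (𝓝 (toSeq z))) : Tendsto w atTop (𝓝 z) := by
  rw [tendsto_pi_nhds] at h
  have hzs := hasSum_of_mem_simplexOfRadius hz
  have hpos : Tendsto (fun j => ∑' k, max (z k - w j k) 0) atTop (𝓝 (∑' _ : ℕ, (0 : ℝ))) := by
    refine tendsto_tsum_of_dominated_convergence hzs.summable (fun k => ?_) (.of_forall fun j k => ?_)
    · have := ((h k).const_sub (z k)).max (tendsto_const_nhds (x := (0 : ℝ)))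
      simpa [toSeq] using this
    · rw [Real.norm_of_nonneg (le_max_right _ _)]
      exact max_le (by linarith [(hw j).1 k]) (hz.1 k)
  rw [tendsto_iff_norm_sub_tendsto_zero]
  have heq : ∀ j, ‖w j - z‖ = 2 * ∑' k, max (z k - w j k) 0 := fun j => by
    have hws := hasSum_of_mem_simplexOfRadius (hw j)
    have hms : Summable fun k => max (z k - w j k) 0 :=
      Summable.of_nonneg_of_le (fun k => le_max_right _ _)
        (fun k => max_le (by linarith [(hw j).1 k]) (hz.1 k)) hzs.summable
    have h1 := (hws.sub hzs).add (hms.hasSum.mul_left 2)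
    rw [EllOne.norm_eq_tsum]
    -- Since `w j` and `z` have equal mass, the norm is twice the mass of `(z - w j)⁺`, which is
    -- dominated by `z`.
    have h2 : ∀ k, |(w j - z) k| = w j k - z k + 2 * max (z k - w j k) 0 := fun k => by
      change |w j k - z k| = _
      rcases le_total (z k) (w j k) with h | h
      · rw [abs_of_nonneg (by linarith), max_eq_right (by linarith)]; ring
      · rw [abs_of_nonpos (by linarith), max_eq_left (by linarith)]; ring
    simp only [h2, h1.tsum_eq]; ring
  simp only [heq]
  simpa using hpos.const_mul 2

/-! ### Flow of mass across a cut -/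

section InfiniteVolterra

variable {a : ℕ → ℕ → ℝ} {m : ℕ} {σ : ℝ}

theorem summable_skew_mul (ha : a ∈ SkewMatrices) {x : ℕ → ℝ} (hx : ∀ k, 0 ≤ x k)
    (hs : Summable x) (k : ℕ) : Summable fun i => a k i * x i :=
  Summable.of_norm_bounded hs fun i => by
    rw [norm_mul, Real.norm_of_nonneg (hx i)]
    exact mul_le_of_le_one_left (hx i) (ha.2 k i)

theorem sum_range_volterra (ha : a ∈ SkewMatrices) {x : ℕ → ℝ} (hx : ∀ k, 0 ≤ x k)
    (hs : Summable x) (N : ℕ) :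
    ∑ k ∈ Finset.range N, x k * (1 + ∑' i, a k i * x i) =
      ∑ k ∈ Finset.range N, x k +
        ∑ k ∈ Finset.range N, x k * ∑' i, a k (i + N) * x (i + N) := by
  have h : ∀ k, ∑' i, a k i * x i =
      ∑ i ∈ Finset.range N, a k i * x i + ∑' i, a k (i + N) * x (i + N) := fun k =>
    ((summable_skew_mul ha hx hs k).sum_add_tsum_nat_add N).symm
  have h0 := sum_mul_sum_skew (Finset.range N) ha.1 x x
  simp only [h, mul_add, mul_one, Finset.sum_add_distrib]
  linarith

/-- Interactions inside the head cancel. The flow across the cut is a sum of terms of sign `σ`, so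
it dominates each single one. -/
theorem le_sum_range_volterra_sub (ha : a ∈ SkewMatrices)
    (hblock : ∀ k i, k < m → m ≤ i → a k i = 0) (hσ : ∀ k i, m ≤ k → k < i → 0 ≤ σ * a k i)
    {x : ℕ → ℝ} (hx : ∀ k, 0 ≤ x k) (hs : Summable x) {N : ℕ} (hN : m ≤ N) :
    (0 ≤ σ * (∑ k ∈ Finset.range N, x k * (1 + ∑' i, a k i * x i) -
      ∑ k ∈ Finset.range N, x k)) ∧
    ∀ k i, m ≤ k → k < N → N ≤ i → σ * a k i * x k * x i ≤
      σ * (∑ k ∈ Finset.range N, x k * (1 + ∑' i, a k i * x i) -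
        ∑ k ∈ Finset.range N, x k) := by
  have hnn : ∀ k < N, ∀ i, 0 ≤ σ * a k (i + N) * x (i + N) := fun k hk i => by
    refine mul_nonneg ?_ (hx _)
    rcases lt_or_ge k m with h | h
    · rw [hblock k _ h (by omega)]; simp
    · exact hσ k _ h (by omega)
  have hterm : ∀ k, σ * (x k * ∑' i, a k (i + N) * x (i + N)) =
      x k * ∑' i, σ * a k (i + N) * x (i + N) := fun k => by
    simp only [mul_assoc, tsum_mul_left]; ring
  rw [sum_range_volterra ha hx hs, add_sub_cancel_left, Finset.mul_sum]
  have hnn' : ∀ k ∈ Finset.range N, 0 ≤ σ * (x k * ∑' i, a k (i + N) * x (i + N)) :=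
    fun k hk => by
      rw [hterm]
      exact mul_nonneg (hx k) (tsum_nonneg (hnn k (Finset.mem_range.mp hk)))
  refine ⟨Finset.sum_nonneg hnn', fun k i _ hkN hNi => ?_⟩
  refine le_trans ?_ (Finset.single_le_sum hnn' (Finset.mem_range.mpr hkN))
  rw [hterm]
  have hsum : Summable fun i => σ * a k (i + N) * x (i + N) := by
    simpa only [mul_assoc] using
      ((summable_nat_add_iff N).mpr (summable_skew_mul ha hx hs k)).mul_left σ
  have h1 := hsum.le_tsum (i - N) fun j _ => hnn k hkN j
  rw [Nat.sub_add_cancel hNi] at h1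
  calc σ * a k i * x k * x i = x k * (σ * a k i * x i) := by ring
    _ ≤ _ := mul_le_mul_of_nonneg_left h1 (hx k)

variable {X : ℕ → ℕ → ℝ}

theorem exists_tendsto_sum_range (ha : a ∈ SkewMatrices)
    (hblock : ∀ k i, k < m → m ≤ i → a k i = 0) (hσ1 : σ = 1 ∨ σ = -1)
    (hσ : ∀ k i, m ≤ k → k < i → 0 ≤ σ * a k i)
    (hX : ∀ n k, 0 ≤ X n k) (hs : ∀ n, HasSum (X n) 1)
    (hstep : ∀ n k, X (n + 1) k = X n k * (1 + ∑' i, a k i * X n i)) {N : ℕ} (hN : m ≤ N) :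
    (Monotone fun n => σ * ∑ k ∈ Finset.range N, X n k) ∧
    ∃ l, Tendsto (fun n => ∑ k ∈ Finset.range N, X n k) atTop (𝓝 l) := by
  have hmono : Monotone fun n => σ * ∑ k ∈ Finset.range N, X n k :=
    monotone_nat_of_le_succ fun n => by
      have := (le_sum_range_volterra_sub ha hblock hσ (hX n) (hs n).summable hN).1
      simp only [← hstep] at this
      linarith
  refine ⟨hmono, ?_⟩
  have hσσ : σ * σ = 1 := by rcases hσ1 with rfl | rfl <;> norm_num
  have hbdd : BddAbove (range fun n => σ * ∑ k ∈ Finset.range N, X n k) := by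
    refine ⟨1, ?_⟩
    rintro _ ⟨n, rfl⟩
    have h1 := sum_le_hasSum (Finset.range N) (fun k _ => hX n k) (hs n)
    have h0 : 0 ≤ ∑ k ∈ Finset.range N, X n k := Finset.sum_nonneg fun k _ => hX n k
    rcases hσ1 with rfl | rfl <;> dsimp only <;> linarith
  refine ⟨_, ((tendsto_atTop_ciSup hmono hbdd).const_mul σ).congr fun n => ?_⟩
  rw [← mul_assoc, hσσ, one_mul]

/-- The head sum up to the cut `k + 1` converges, so its increments tend to zero, and with them the
dominated term `σ a_{ki} x_k x_i`. -/
theorem eq_zero_of_positive_cluster (ha : a ∈ SkewMatrices)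
    (hblock : ∀ k i, k < m → m ≤ i → a k i = 0) (hσ1 : σ = 1 ∨ σ = -1)
    (hσ : ∀ k i, m ≤ k → k < i → 0 ≤ σ * a k i)
    (hX : ∀ n k, 0 ≤ X n k) (hs : ∀ n, HasSum (X n) 1)
    (hstep : ∀ n k, X (n + 1) k = X n k * (1 + ∑' i, a k i * X n i))
    {y : ℕ → ℝ} (hy : ∀ k, 0 < y k) {φ : ℕ → ℕ} (hφ : StrictMono φ)
    (hlim : ∀ k, Tendsto (fun j => X (φ j) k) atTop (𝓝 (y k))) {k i : ℕ} (hk : m ≤ k)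
    (hki : k < i) : a k i = 0 := by
  have hkm : m ≤ k + 1 := by omega
  obtain ⟨-, l, hl⟩ := exists_tendsto_sum_range ha hblock hσ1 hσ hX hs hstep hkm
  have h1 : Tendsto (fun j => σ * (∑ k ∈ Finset.range (k + 1), X (φ j + 1) k -
      ∑ k ∈ Finset.range (k + 1), X (φ j) k)) atTop (𝓝 (σ * (l - l))) :=
    ((hl.comp ((tendsto_add_atTop_nat 1).comp hφ.tendsto_atTop)).sub
      (hl.comp hφ.tendsto_atTop)).const_mul σ
  have h2 : Tendsto (fun j => σ * a k i * X (φ j) k * X (φ j) i) atTop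
      (𝓝 (σ * a k i * y k * y i)) := ((hlim k).const_mul _).mul (hlim i)
  have h3 := le_of_tendsto_of_tendsto' h2 h1 fun j => by
    have := (le_sum_range_volterra_sub ha hblock hσ (hX (φ j)) (hs _).summable hkm).2 k i hk
      (by omega) (by omega)
    simpa only [← hstep] using this
  rw [sub_self, mul_zero, mul_assoc] at h3
  have h4 : σ * a k i ≤ 0 := by
    by_contra! h
    exact absurd h3 (not_le.mpr (mul_pos h (mul_pos (hy k) (hy i))))
  have h5 := le_antisymm h4 (hσ k i hk hki)
  rcases hσ1 with rfl | rfl <;> linarith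

theorem one_add_sum_pos (ha : a ∈ SkewMatrices) {y : ℕ → ℝ} (hy : ∀ k, 0 < y k)
    (hy1 : ∀ N, ∑ k ∈ Finset.range N, y k ≤ 1) {k : ℕ} (hk : k < m) :
    0 < 1 + ∑ i ∈ Finset.range m, a k i * y i := by
  have hkk : a k k = 0 := by have := ha.1 k k; linarith
  have h : -∑ i ∈ Finset.range m, y i + y k ≤ ∑ i ∈ Finset.range m, a k i * y i := by
    have hkm := Finset.mem_range.mpr hk
    rw [← Finset.add_sum_erase _ _ hkm, ← Finset.add_sum_erase _ (fun i => a k i * y i) hkm, hkk]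
    have : -∑ i ∈ (Finset.range m).erase k, y i ≤
        ∑ i ∈ (Finset.range m).erase k, a k i * y i := by
      rw [← Finset.sum_neg_distrib]
      refine Finset.sum_le_sum fun i _ => ?_
      nlinarith [(abs_le.mp (ha.2 k i)).1, hy i]
    linarith
  linarith [hy1 m, hy k]

/-- A Volterra orbit with a positive pointwise cluster point is stationary. -/
theorem volterra_stationary (ha : a ∈ SkewMatrices)
    (hblock : ∀ k i, k < m → m ≤ i → a k i = 0) (hσ1 : σ = 1 ∨ σ = -1)
    (hσ : ∀ k i, m ≤ k → k < i → 0 ≤ σ * a k i)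
    (hX : ∀ n k, 0 ≤ X n k) (hs : ∀ n, HasSum (X n) 1)
    (hstep : ∀ n k, X (n + 1) k = X n k * (1 + ∑' i, a k i * X n i))
    {y : ℕ → ℝ} (hy : ∀ k, 0 < y k) {φ : ℕ → ℕ} (hφ : StrictMono φ)
    (hlim : ∀ k, Tendsto (fun j => X (φ j) k) atTop (𝓝 (y k))) (k : ℕ) : X 1 k = X 0 k := by
  have hoff : ∀ k i, m ≤ i → a k i = 0 := fun k i hi => by
    rcases lt_or_ge k m with h | h
    · exact hblock k i h hi
    rcases lt_trichotomy k i with h' | rfl | h'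
    · exact eq_zero_of_positive_cluster ha hblock hσ1 hσ hX hs hstep hy hφ hlim h h'
    · have := ha.1 k k; linarith
    · rw [ha.1, eq_zero_of_positive_cluster ha hblock hσ1 hσ hX hs hstep hy hφ hlim hi h', neg_zero]
  have htsum : ∀ (x : ℕ → ℝ) k, ∑' i, a k i * x i = ∑ i : Fin m, a k i * x i := fun x k => by
    rw [← Finset.sum_range fun i => a k i * x i]
    refine tsum_eq_sum fun i hi => ?_
    rw [hoff k i (by simpa using hi), zero_mul]
  -- A coordinate that vanishes once stays zero, contradicting its positive limit.
  have hpos : ∀ n k, 0 < X n k := fun n k => by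
    refine (hX n k).lt_of_ne' fun h0 => ?_
    have hzero : ∀ j, X (n + j) k = 0 := fun j => by
      induction j with
      | zero => exact h0
      | succ j ih => rw [← add_assoc, hstep, ih, zero_mul]
    obtain ⟨j, hj, hj'⟩ := (((hlim k).eventually_const_lt (hy k)).and
      (hφ.tendsto_atTop.eventually_ge_atTop n)).exists
    have := hzero (φ j - n)
    rw [Nat.add_sub_cancel' hj'] at this
    linarith
  have hy1 : ∀ N, ∑ k ∈ Finset.range N, y k ≤ 1 := fun N =>
    le_of_tendsto' (tendsto_finsetSum _ fun k _ => hlim k) fun j =>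
      sum_le_hasSum _ (fun k _ => hX _ k) (hs _)
  obtain ⟨hBy, hu⟩ := finite_volterra_stationary (B := fun k i : Fin m => a k i)
    (u := fun n k => X n k) (y := fun k => y k) (fun k i => ha.1 k i) (fun n k => hpos n k)
    (fun n k => by rw [hstep, htsum]) (fun k => hy k)
    (fun k => by
      rw [← Finset.sum_range fun i => a k i * y i]
      exact one_add_sum_pos ha hy hy1 k.2) hφ fun k => hlim k
  have hu' : ∀ i : Fin m, X 0 i = y i := fun i => congrFun hu i
  have hfix : ∑ i : Fin m, a k i * X 0 i = 0 := by
    rcases lt_or_ge k m with h | h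
    · simp only [hu']; exact hBy ⟨k, h⟩
    · exact Finset.sum_eq_zero fun i _ => by
        rw [ha.1, hblock _ _ i.2 h, neg_zero, zero_mul]
  rw [hstep, htsum, hfix, add_zero, mul_one]

end InfiniteVolterra

/-! ### Structure of the two limit sets -/

section OmegaLimit

variable {V : InfSimplex → InfSimplex} {a : ℕ → ℕ → ℝ} {m : ℕ} {σ : ℝ}

theorem mem_omegaPointwise_iff {x₀ : InfSimplex} {y : ℕ → ℝ} :
    y ∈ omegaPointwise V x₀ ↔ ∃ φ : ℕ → ℕ, StrictMono φ ∧
      Tendsto (fun j => toSeq (V^[φ j] x₀).1) atTop (𝓝 y) :=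
  mem_iInter_closure_tail_iff (fun k => toSeq (V^[k] x₀).1) y

theorem mem_omegaNorm_iff {x₀ : InfSimplex} {z : EllOne} :
    z ∈ omegaNorm V x₀ ↔ ∃ φ : ℕ → ℕ, StrictMono φ ∧
      Tendsto (fun j => (V^[φ j] x₀).1) atTop (𝓝 z) :=
  mem_iInter_closure_tail_iff (fun k => (V^[k] x₀).1) z

theorem omegaPointwise_nonempty (x₀ : InfSimplex) : (omegaPointwise V x₀).Nonempty := by
  have hmem : ∀ n, toSeq (V^[n] x₀).1 ∈ Set.univ.pi fun _ : ℕ => Icc (0 : ℝ) 1 := fun n k _ =>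
    ⟨(V^[n] x₀).2.1 k, le_hasSum (hasSum_of_mem_simplexOfRadius (V^[n] x₀).2) k
      fun i _ => (V^[n] x₀).2.1 i⟩
  obtain ⟨y, -, φ, hφ, hlim⟩ :=
    (isCompact_univ_pi fun _ : ℕ => isCompact_Icc (a := (0 : ℝ)) (b := 1)).tendsto_subseq hmem
  exact ⟨y, mem_omegaPointwise_iff.mpr ⟨φ, hφ, hlim⟩⟩

theorem toSeq_mem_omegaPointwise {x₀ : InfSimplex} {z : EllOne} (hz : z ∈ omegaNorm V x₀) :
    toSeq z ∈ omegaPointwise V x₀ := by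
  obtain ⟨φ, hφ, hlim⟩ := mem_omegaNorm_iff.mp hz
  exact mem_omegaPointwise_iff.mpr ⟨φ, hφ, (continuous_toSeq.tendsto z).comp hlim⟩

theorem mem_simplex_of_mem_omegaNorm {x₀ : InfSimplex} {z : EllOne} (hz : z ∈ omegaNorm V x₀) :
    z ∈ simplexOfRadius 1 := by
  obtain ⟨φ, -, hlim⟩ := mem_omegaNorm_iff.mp hz
  exact (isClosed_simplexOfRadius 1).mem_of_tendsto hlim (.of_forall fun j => (V^[φ j] x₀).2)

theorem mem_omegaNorm_of_toSeq_mem {x₀ : InfSimplex} {z : EllOne} (hz : z ∈ simplexOfRadius 1)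
    (h : toSeq z ∈ omegaPointwise V x₀) : z ∈ omegaNorm V x₀ := by
  obtain ⟨φ, hφ, hlim⟩ := mem_omegaPointwise_iff.mp h
  exact mem_omegaNorm_iff.mpr
    ⟨φ, hφ, tendsto_of_tendsto_coord (fun j => (V^[φ j] x₀).2) hz hlim⟩

theorem image_omegaNorm_eq {x₀ : InfSimplex}
    (h : omegaPointwise V x₀ ⊆ toSeq '' simplexOfRadius 1) :
    toSeq '' omegaNorm V x₀ = omegaPointwise V x₀ := by
  refine Subset.antisymm (image_subset_iff.mpr fun z hz => toSeq_mem_omegaPointwise hz) ?_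
  intro y hy
  obtain ⟨z, hz, rfl⟩ := h hy
  exact ⟨z, mem_omegaNorm_of_toSeq_mem hz hy, rfl⟩

theorem hasSum_iterate (x₀ : InfSimplex) (n : ℕ) : HasSum (fun k => (V^[n] x₀).1 k) 1 :=
  hasSum_of_mem_simplexOfRadius (V^[n] x₀).2

theorem iterate_succ_coord (hV : IsVolterraWith V a) (x₀ : InfSimplex) (n k : ℕ) :
    (V^[n + 1] x₀).1 k = (V^[n] x₀).1 k * (1 + ∑' i, a k i * (V^[n] x₀).1 i) := by
  rw [Function.iterate_succ_apply', hV.2]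

/-- Every cluster point has the limits of the head sums as its own head sums, which fixes its total
mass. -/
theorem exists_radius (hV : IsVolterraWith V a) (hblock : ∀ k i, k < m → m ≤ i → a k i = 0)
    (hσ1 : σ = 1 ∨ σ = -1) (hσ : ∀ k i, m ≤ k → k < i → 0 ≤ σ * a k i) (x₀ : InfSimplex) :
    ∃ r, 0 ≤ r ∧ r ≤ 1 ∧ (σ = 1 → r = 1) ∧
      omegaPointwise V x₀ ⊆ toSeq '' simplexOfRadius r := by
  have hX : ∀ n k, 0 ≤ (V^[n] x₀).1 k := fun n => (V^[n] x₀).2.1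
  have hs := hasSum_iterate (V := V) x₀
  have hconv : ∀ N, m ≤ N → _ := fun N hN =>
    exists_tendsto_sum_range hV.1 hblock hσ1 hσ hX hs (iterate_succ_coord hV x₀) hN
  have hprop : ∀ y ∈ omegaPointwise V x₀, (∀ k, 0 ≤ y k) ∧ Summable y ∧ ∑' k, y k ≤ 1 ∧
      ∀ N, m ≤ N → Tendsto (fun n => ∑ k ∈ Finset.range N, (V^[n] x₀).1 k) atTop
        (𝓝 (∑ k ∈ Finset.range N, y k)) := fun y hy => by
    obtain ⟨φ, hφ, hlim⟩ := mem_omegaPointwise_iff.mp hy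
    rw [tendsto_pi_nhds] at hlim
    have h0 : ∀ k, 0 ≤ y k := fun k => ge_of_tendsto' (hlim k) fun j => hX _ k
    have hlimN : ∀ N, Tendsto (fun j => ∑ k ∈ Finset.range N, (V^[φ j] x₀).1 k) atTop
        (𝓝 (∑ k ∈ Finset.range N, y k)) := fun N => tendsto_finsetSum _ fun k _ => hlim k
    have h1 : ∀ N, ∑ k ∈ Finset.range N, y k ≤ 1 := fun N =>
      le_of_tendsto' (hlimN N) fun j => sum_le_hasSum _ (fun k _ => hX _ k) (hs _)
    refine ⟨h0, summable_of_sum_range_le h0 h1, Real.tsum_le_of_sum_range_le h0 h1,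
      fun N hN => ?_⟩
    obtain ⟨-, l, hl⟩ := hconv N hN
    rwa [tendsto_nhds_unique (hlimN N) (hl.comp hφ.tendsto_atTop)]
  obtain ⟨y, hy⟩ := omegaPointwise_nonempty (V := V) x₀
  obtain ⟨hy0, hysum, hy1, hyN⟩ := hprop y hy
  refine ⟨∑' k, y k, tsum_nonneg hy0, hy1, fun h1 => le_antisymm hy1 ?_, fun w hw => ?_⟩
  -- For `σ = 1` the head sums of `x₀` are at most those of `y`; let `N` tend to infinity.
  · refine le_of_tendsto_of_tendsto (hs 0).tendsto_sum_nat hysum.hasSum.tendsto_sum_nat ?_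
    filter_upwards [eventually_ge_atTop m] with N hN
    have hmono := (hconv N hN).1
    simp only [h1, one_mul] at hmono
    exact hmono.ge_of_tendsto (hyN N hN) 0
  · obtain ⟨hw0, hwsum, -, hwN⟩ := hprop w hw
    refine exists_mem_simplexOfRadius hw0 ?_
    have : ∑' k, w k = ∑' k, y k := by
      refine tendsto_nhds_unique hwsum.hasSum.tendsto_sum_nat
        (hysum.hasSum.tendsto_sum_nat.congr' ?_)
      filter_upwards [eventually_ge_atTop m] with N hN
      exact tendsto_nhds_unique (hyN N hN) (hwN N hN)
    exact this ▸ hwsum.hasSum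

theorem omegaPointwise_subset_bdSimplex (hV : IsVolterraWith V a)
    (hblock : ∀ k i, k < m → m ≤ i → a k i = 0)
    (hσ1 : σ = 1 ∨ σ = -1) (hσ : ∀ k i, m ≤ k → k < i → 0 ≤ σ * a k i) {x₀ : InfSimplex}
    (hx₀ : x₀ ∉ Function.fixedPoints V) {r : ℝ}
    (hr : omegaPointwise V x₀ ⊆ toSeq '' simplexOfRadius r) :
    omegaPointwise V x₀ ⊆ toSeq '' bdSimplex r := by
  intro y hy
  obtain ⟨z, hz, rfl⟩ := hr hy
  refine ⟨z, ⟨hz, fun hri => hx₀ ?_⟩, rfl⟩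
  obtain ⟨φ, hφ, hlim⟩ := mem_omegaPointwise_iff.mp hy
  rw [tendsto_pi_nhds] at hlim
  exact Subtype.ext (lp.ext (funext fun k =>
    volterra_stationary (X := fun n k => (V^[n] x₀).1 k) hV.1 hblock hσ1 hσ
      (fun n => (V^[n] x₀).2.1) (hasSum_iterate x₀) (iterate_succ_coord hV x₀) hri.2 hφ hlim k))

end OmegaLimit

/-! ### The two classes -/

theorem theorem1p1 (V : InfSimplex → InfSimplex)
    (hV : V ∈ VolterraPlusTilde ∪ VolterraMinusTilde) (hne : V ≠ id) :
    (V ∈ VolterraPlusTilde →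
      (∀ x₀ : InfSimplex,
        toSeq '' omegaNorm V x₀ = omegaPointwise V x₀ ∧ (omegaNorm V x₀).Nonempty) ∧
      ∀ x₀ : InfSimplex, x₀ ∉ Function.fixedPoints V →
        omegaPointwise V x₀ ⊆ toSeq '' bdSimplex 1) ∧
    (V ∈ VolterraMinusTilde →
      ∀ x₀ : InfSimplex, x₀ ∉ Function.fixedPoints V →
        ((omegaNorm V x₀).Nonempty →
          toSeq '' omegaNorm V x₀ = omegaPointwise V x₀ ∧
            omegaPointwise V x₀ ⊆ toSeq '' bdSimplex 1) ∧
        (omegaNorm V x₀ = ∅ →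
          ∃ r : ℝ, 0 ≤ r ∧ r < 1 ∧ (omegaPointwise V x₀).Nonempty ∧
            omegaPointwise V x₀ ⊆ toSeq '' bdSimplex r)) := by
  refine ⟨?_, ?_⟩
  · rintro ⟨a, ha, m, hblock, hσ⟩
    have hσ' : ∀ k i, m ≤ k → k < i → 0 ≤ (1 : ℝ) * a k i := by simpa using hσ
    have hsub : ∀ x₀, omegaPointwise V x₀ ⊆ toSeq '' simplexOfRadius 1 := fun x₀ => by
      obtain ⟨r, -, -, hr1, hr⟩ := exists_radius ha hblock (Or.inl rfl) hσ' x₀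
      rwa [hr1 rfl] at hr
    refine ⟨fun x₀ => ⟨image_omegaNorm_eq (hsub x₀), ?_⟩, fun x₀ hx₀ =>
      omegaPointwise_subset_bdSimplex ha hblock (Or.inl rfl) hσ' hx₀ (hsub x₀)⟩
    rw [← image_nonempty, image_omegaNorm_eq (hsub x₀)]
    exact omegaPointwise_nonempty x₀
  · rintro ⟨a, ha, m, hblock, hσ⟩ x₀ hx₀
    have hσ' : ∀ k i, m ≤ k → k < i → 0 ≤ (-1 : ℝ) * a k i := by simpa using hσ
    obtain ⟨r, hr0, hr1, -, hr⟩ := exists_radius ha hblock (Or.inr rfl) hσ' x₀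
    have hbd := omegaPointwise_subset_bdSimplex ha hblock (Or.inr rfl) hσ' hx₀ hr
    refine ⟨fun ⟨z, hz⟩ => ?_, fun hempty => ?_⟩
    -- A norm limit point keeps mass one, and it is also a pointwise one, so the common radius is
    -- one.
    · obtain ⟨z', hz', heq⟩ := hr (toSeq_mem_omegaPointwise hz)
      obtain rfl : z' = z := lp.ext heq
      obtain rfl : r = 1 := hz'.2.symm.trans (mem_simplex_of_mem_omegaNorm hz).2
      exact ⟨image_omegaNorm_eq hr, hbd⟩
    · obtain ⟨y, hy⟩ := omegaPointwise_nonempty (V := V) x₀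
      refine ⟨r, hr0, hr1.lt_of_ne ?_, ⟨y, hy⟩, hbd⟩
      rintro rfl
      obtain ⟨z, hz, rfl⟩ := hr hy
      exact hempty.subset (mem_omegaNorm_of_toSeq_mem hz hy)
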